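/- Let $d_Q\ge 2$ be an integer and let $\epsilon,\delta\ge 0$ satisfy $\epsilon+\delta<2\left(1-\tfrac{1}{\sqrt{d_Q}}\right)$ (for a qubit secret, $d_Q=2$, this includes $\epsilon=\delta=0.09$). A CDQS protocol (conditional disclosure of secrets with quantum resources) on $n$-bit inputs consists of a resource state $\Psi_{LR}$, where each of $L$ and $R$ has $E$ qubits, and of quantum channels $\mathcal N^x_{QL\to M_A}$ for Alice ($x\in\{0,1\}^n$) and $\mathcal N^y_{R\to M_B}$ for Bob ($y\in\{0,1\}^n$), where $Q$ is the $d_Q$-dimensional secret system and the messages $M_A$, $M_B$ to the referee have $q_A$ and $q_B$ qubits. Put $M=M_AM_B$ and $\mathcal N^{x,y}_{Q\to M}(\cdot)=(\mathcal N^x\otimes\mathcal N^y)(\,\cdot\otimes\Psi_{LR})$. For $f:\{0,1\}^n\times\{0,1\}^n\to\{0,1\}$ the protocol is $\epsilon$-correct if for all $(x,y)$ with $f(x,y)=1$ there is a channel $\mathcal D^{x,y}_{M\to Q}$ with $\|\mathcal D^{x,y}\circ\mathcal N^{x,y}-\mathcal I_Q\|_\diamond\le\epsilon$, and $\delta$-secure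 if for all $(x,y)$ with $f(x,y)=0$ there is a channel $\mathcal S^{x,y}_{\varnothing\to M}$ from the trivial system with $\|\mathcal S^{x,y}\circ\mathrm{tr}_Q-\mathcal N^{x,y}\|_\diamond\le\delta$. Here the diamond distance of two channels is the supremum of the trace-norm distance of their outputs, over all density matrices on the input system together with a reference system of arbitrary finite dimension. Let $\mathsf R_{0,A\to B}(f)$ be the zero-error classical one-way communication complexity of $f$: the least $c$ such that Alice, given $x$, can send Bob a (possibly randomized) $c$-bit message from which Bob, given $y$, outputs $f(x,y)$ with probability $1$, for all $x,y$. Let $\mathsf R_{0,B\to A}(f)$ be the same with the roles of Alice and Bob interchanged. Logarithms are to base $2$, and $\log 0$ is read as $0$. Then there is a constant $C$, depending only on $\epsilon,\delta,d_Q$, such that for all $n,E,q_A,q_B$, all $f$, and every $\epsilon$-correct and $\delta$-secure CDQS protocol for $f$ with these parameters, $$q_B+E\;\ge\;\tfrac12\log \mathsf R_{0,B\to A}(f)-C\log(q_B+E+2)$$ and $$q_A+E\;\ge\;\tfrac12\log \mathsf R_{0,A\to B}(f)-C\log(q_A+E+2).$$ In particular, up to terms logarithmic in $q_B+E$ (respectively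 $q_A+E$), $q_B+E\ge\tilde\Omega(\log\mathsf R_{0,B\to A}(f))$ and $q_A+E\ge\tilde\Omega(\log\mathsf R_{0,A\to B}(f))$. -/

import Mathlib

open scoped Kronecker ENNReal ComplexOrder

noncomputable section

/-- Bit strings of length `k`. -/
abbrev BitString (k : ℕ) : Type := Fin k → Bool

/-- Labels of the computational basis of a system of `k` qubits: the Hilbert space is `ℂ^(2^k)`,
with basis indexed by bit strings. -/
abbrev Qubits (k : ℕ) : Type := Fin k → Bool

/-! ### Quantum states and channels in finite dimension -/

section Quantum

variable {a b c d : Type} [Fintype a] [DecidableEq a] [Fintype b] [DecidableEq b]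
  [Fintype c] [DecidableEq c] [Fintype d] [DecidableEq d]

/-- Density matrices: positive semidefinite of unit trace. -/
def IsDensity (ρ : Matrix a a ℂ) : Prop := ρ.PosSemidef ∧ ρ.trace = 1

/-- `‖A‖₁ = tr √(Aᴴ A)`, the sum of the singular values of `A`. -/
def traceNorm (A : Matrix a a ℂ) : ℝ :=
  ∑ i, Real.sqrt ((Matrix.isHermitian_conjTranspose_mul_self A).eigenvalues i)

/-- The linear map `id_c ⊗ T`. -/
def idTensor (c : Type) (T : Matrix a a ℂ →ₗ[ℂ] Matrix b b ℂ) :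
    Matrix (c × a) (c × a) ℂ →ₗ[ℂ] Matrix (c × b) (c × b) ℂ where
  toFun X := Matrix.of fun p q =>
    T (Matrix.of fun i j => X (p.1, i) (q.1, j)) p.2 q.2
  map_add' X Y := by
    ext p q
    exact congrFun (congrFun (map_add T (Matrix.of fun i j => X (p.1, i) (q.1, j))
      (Matrix.of fun i j => Y (p.1, i) (q.1, j))) p.2) q.2
  map_smul' r X := by
    ext p q
    exact congrFun (congrFun (map_smul T r
      (Matrix.of fun i j => X (p.1, i) (q.1, j))) p.2) q.2

/-- The linear map `T ⊗ id_c`. -/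
def tensorId (c : Type) (T : Matrix a a ℂ →ₗ[ℂ] Matrix b b ℂ) :
    Matrix (a × c) (a × c) ℂ →ₗ[ℂ] Matrix (b × c) (b × c) ℂ where
  toFun X := Matrix.of fun p q =>
    T (Matrix.of fun i j => X (i, p.2) (j, q.2)) p.1 q.1
  map_add' X Y := by
    ext p q
    exact congrFun (congrFun (map_add T (Matrix.of fun i j => X (i, p.2) (j, q.2))
      (Matrix.of fun i j => Y (i, p.2) (j, q.2))) p.1) q.1
  map_smul' r X := by
    ext p q
    exact congrFun (congrFun (map_smul T r
      (Matrix.of fun i j => X (i, p.2) (j, q.2))) p.1) q.1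

/-- The linear map `T ⊗ S`. -/
def tensorMap (T : Matrix a a ℂ →ₗ[ℂ] Matrix b b ℂ) (S : Matrix c c ℂ →ₗ[ℂ] Matrix d d ℂ) :
    Matrix (a × c) (a × c) ℂ →ₗ[ℂ] Matrix (b × d) (b × d) ℂ :=
  tensorId d T ∘ₗ idTensor a S

/-- Quantum channels: completely positive trace-preserving linear maps. -/
def IsChannel (T : Matrix a a ℂ →ₗ[ℂ] Matrix b b ℂ) : Prop :=
  (∀ (k : ℕ) (X : Matrix (Fin k × a) (Fin k × a) ℂ),
    X.PosSemidef → (idTensor (Fin k) T X).PosSemidef) ∧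
  ∀ X : Matrix a a ℂ, (T X).trace = X.trace

/-- The diamond norm distance: the supremum, over all dimensions `k` of a reference system and all
density matrices `ω` on the reference and the input, of `‖(id ⊗ T) ω - (id ⊗ S) ω‖₁`. -/
def diamondDist (T S : Matrix a a ℂ →ₗ[ℂ] Matrix b b ℂ) : ℝ≥0∞ :=
  ⨆ (k : ℕ) (ω : Matrix (Fin k × a) (Fin k × a) ℂ) (_ : IsDensity ω),
    ENNReal.ofReal (traceNorm (idTensor (Fin k) T ω - idTensor (Fin k) S ω))

/-- The trace, as a map to the operators on the one-dimensional (trivial) system. -/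
def traceOut (a : Type) [Fintype a] : Matrix a a ℂ →ₗ[ℂ] Matrix Unit Unit ℂ where
  toFun X := Matrix.of fun _ _ => X.trace
  map_add' X Y := by ext; simp
  map_smul' r X := by ext; simp

/-- `X ↦ X ⊗ Ψ`, with the systems grouped as `(Q L) R` for `Ψ` on `L R`. -/
def appendState {L R : Type} (a : Type) (Ψ : Matrix (L × R) (L × R) ℂ) :
    Matrix a a ℂ →ₗ[ℂ] Matrix ((a × L) × R) ((a × L) × R) ℂ where
  toFun X := (X ⊗ₖ Ψ).submatrix (Equiv.prodAssoc a L R) (Equiv.prodAssoc a L R)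
  map_add' X Y := by ext; simp [Matrix.add_kronecker]
  map_smul' r X := by ext; simp [Matrix.smul_kronecker]

end Quantum

/-! ### Conditional disclosure of secrets with quantum resources -/

/-- A CDQS protocol on `n`-bit inputs with a `dQ`-dimensional secret system `Q`: a resource state
`Ψ` on `L R`, each of `L`, `R` having `E` qubits, a channel `Q L → M_A` for every input of Alice,
and a channel `R → M_B` for every input of Bob, where `M_A` has `qA` and `M_B` has `qB` qubits. -/
structure CDQSProtocol (n dQ E qA qB : ℕ) where
  resource : Matrix (Qubits E × Qubits E) (Qubits E × Qubits E) ℂ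
  resource_isDensity : IsDensity resource
  alice : BitString n →
    Matrix (Fin dQ × Qubits E) (Fin dQ × Qubits E) ℂ →ₗ[ℂ] Matrix (Qubits qA) (Qubits qA) ℂ
  alice_isChannel : ∀ x, IsChannel (alice x)
  bob : BitString n → Matrix (Qubits E) (Qubits E) ℂ →ₗ[ℂ] Matrix (Qubits qB) (Qubits qB) ℂ
  bob_isChannel : ∀ y, IsChannel (bob y)

namespace CDQSProtocol

variable {n dQ E qA qB : ℕ}

/-- The combined channel `Q → M_A M_B` on inputs `x`, `y`: the secret is adjoined to the resource
state, then Alice and Bob apply their local channels. -/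
def encode (P : CDQSProtocol n dQ E qA qB) (x y : BitString n) :
    Matrix (Fin dQ) (Fin dQ) ℂ →ₗ[ℂ]
      Matrix (Qubits qA × Qubits qB) (Qubits qA × Qubits qB) ℂ :=
  tensorMap (P.alice x) (P.bob y) ∘ₗ appendState (Fin dQ) P.resource

/-- `ε`-correctness: whenever `f(x,y) = 1` a decoder recovers the secret. -/
def IsCorrect (P : CDQSProtocol n dQ E qA qB) (f : BitString n → BitString n → Bool) (ε : ℝ) :
    Prop :=
  ∀ x y, f x y = true →
    ∃ D : Matrix (Qubits qA × Qubits qB) (Qubits qA × Qubits qB) ℂ →ₗ[ℂ]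
        Matrix (Fin dQ) (Fin dQ) ℂ,
      IsChannel D ∧ diamondDist (D ∘ₗ P.encode x y) LinearMap.id ≤ ENNReal.ofReal ε

/-- `δ`-security: whenever `f(x,y) = 0` a simulator, which is a channel from the trivial system,
produces the messages without access to the secret. -/
def IsSecure (P : CDQSProtocol n dQ E qA qB) (f : BitString n → BitString n → Bool) (δ : ℝ) :
    Prop :=
  ∀ x y, f x y = false →
    ∃ S : Matrix Unit Unit ℂ →ₗ[ℂ]
        Matrix (Qubits qA × Qubits qB) (Qubits qA × Qubits qB) ℂ,
      IsChannel S ∧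
        diamondDist (S ∘ₗ traceOut (Fin dQ)) (P.encode x y) ≤ ENNReal.ofReal δ

end CDQSProtocol

/-! ### Classical one-way communication complexity -/

/-- A randomized one-way protocol with `c`-bit messages: the sender, who holds the first input,
draws a message; the receiver, who holds the second input, draws an output bit. -/
structure OneWayProtocol (n c : ℕ) where
  send : BitString n → PMF (BitString c)
  output : BitString n → BitString c → PMF Bool

/-- `Pr[z = f(u,v)] ≥ 1 - δ` for all inputs, the sender holding `u` and the receiver `v`. -/
def OneWayProtocol.IsCorrect {n c : ℕ} (π : OneWayProtocol n c)
    (f : BitString n → BitString n → Bool) (δ : ℝ) : Prop :=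
  ∀ u v, 1 - δ ≤ (((π.send u).bind (π.output v)) (f u v)).toReal

/-- `R_{δ,A→B}(f)`: the least number of bits in a `δ`-correct one-way protocol in which Alice (who
holds the first argument of `f`) sends and Bob outputs. -/
def oneWayAB (δ : ℝ) {n : ℕ} (f : BitString n → BitString n → Bool) : ℕ :=
  sInf {c : ℕ | ∃ π : OneWayProtocol n c, π.IsCorrect f δ}

/-- `R_{δ,B→A}(f)`: the same with the roles of Alice and Bob interchanged. -/
def oneWayBA (δ : ℝ) {n : ℕ} (f : BitString n → BitString n → Bool) : ℕ :=
  oneWayAB δ fun y x => f x y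

end

/-! A receiver who knows the sender's encoding channel to sufficient precision can compute `f`:
replacing that channel by a close one cannot turn a disclosed secret into a hidden one. Take the
decoder `D` of an input pair with `f = 1` and the simulated state `σ` of a pair with `f = 0`. Some
basis label `i` has probability at most `1/dQ` in `D σ`. For the secret `i`, outcome `i` of `D` then
has probability at least `1 - ε/2` on the first pair and at most `1/dQ + δ/2` on the second, which
is a positive constant gap (`exists_effect_separating`). Changing the values of one party's channel
on matrix units by `η`, entrywise, moves such a probability by at most a constant times `16 ^ (2E +
q)`, to first power in `dQ ^ 2`, times `η` (`norm_idTensor_sub_le`, `norm_tensorId_sub_le`, with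
crude entrywise bounds). Hence `O(q + E + 1)` bits per entry suffice. The channel has `O(4 ^ (q +
E))` entries, so sending all of them rounded is a deterministic, error-free one-way protocol, and
logarithms give the bound. -/

section Effects

/-! ### Effects, the trace norm and entrywise bounds. -/

set_option linter.unusedSectionVars false

open Matrix

variable {a b c d : Type} [Fintype a] [DecidableEq a] [Fintype b] [DecidableEq b]
  [Fintype c] [DecidableEq c] [Fintype d] [DecidableEq d]

/-- The trace norm of a Hermitian matrix is the sum of the absolute values of its eigenvalues. -/
theorem traceNorm_eq_sum_abs_eigenvalues {A : Matrix a a ℂ} (hA : A.IsHermitian) :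
    traceNorm A = ∑ i, |hA.eigenvalues i| := by
  have hcfc : cfc (fun x : ℝ => x ^ 2) A = Aᴴ * A := by
    have hsa : IsSelfAdjoint A := hA
    have h := cfc_pow_id (R := ℝ) A 2 hsa
    rw [hA.eq, ← pow_two, ← h]
  -- The eigenvalues of `Aᴴ * A` are not matched index by index with the squares of those of `A`.
  -- Equal characteristic polynomials give equal multisets, enough for the sum.
  have h1 := hA.charpoly_cfc_eq (fun x : ℝ => x ^ 2)
  rw [hcfc, (isHermitian_conjTranspose_mul_self A).charpoly_eq] at h1
  have h2 := congrArg (fun p => (p.roots.map fun z : ℂ => Real.sqrt z.re).sum) h1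
  have hne : ∀ g : a → ℂ, (∏ i, (Polynomial.X - Polynomial.C (g i))).roots =
      Finset.univ.val.map g := by
    intro g
    rw [Polynomial.roots_prod _ _ (by simp [Finset.prod_ne_zero_iff, Polynomial.X_sub_C_ne_zero])]
    simp
  simp only [hne, Multiset.map_map] at h2
  have h3 : ∀ g : a → ℝ, (Finset.univ.val.map g).sum = ∑ i, g i := fun _ => rfl
  rw [h3, h3] at h2
  simpa [traceNorm, ← Complex.ofReal_pow, Real.sqrt_sq_eq_abs] using h2

/-- Effects, as functionals: positive and dominated by the trace. -/
def IsEffect (φ : Matrix a a ℂ →ₗ[ℂ] ℂ) : Prop :=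
  ∀ X : Matrix a a ℂ, X.PosSemidef → 0 ≤ φ X ∧ φ X ≤ X.trace

/-- An effect distinguishes the parts of a traceless Hermitian matrix by at most half of the
trace norm. -/
theorem IsEffect.re_le_half_traceNorm {φ : Matrix a a ℂ →ₗ[ℂ] ℂ} (hφ : IsEffect φ)
    {A : Matrix a a ℂ} (hA : A.IsHermitian) (htr : A.trace = 0) :
    (φ A).re ≤ traceNorm A / 2 := by
  set U : Matrix a a ℂ := (hA.eigenvectorUnitary : Matrix a a ℂ) with hU
  have hUU : Uᴴ * U = 1 := by
    have := Unitary.coe_star_mul_self hA.eigenvectorUnitary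
    simpa [star_eq_conjTranspose] using this
  set v := hA.eigenvalues with hv
  have hspec : A = U * diagonal (fun i => (v i : ℂ)) * Uᴴ := by
    conv_lhs => rw [hA.spectral_theorem, Unitary.conjStarAlgAut_apply]
    rfl
  -- `P` is the positive part of `A`, so `φ A ≤ φ P ≤ tr P`; as `tr A = 0`, `tr P` is half the trace
  -- norm.
  set P : Matrix a a ℂ := U * diagonal (fun i => ((max (v i) 0 : ℝ) : ℂ)) * Uᴴ with hP
  have hPpos : P.PosSemidef := by
    refine PosSemidef.mul_mul_conjTranspose_same (PosSemidef.diagonal fun i => ?_) U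
    simp only [Pi.zero_apply]
    exact_mod_cast le_max_right _ _
  have hPA : (P - A).PosSemidef := by
    have : P - A = U * diagonal (fun i => ((max (v i) 0 - v i : ℝ) : ℂ)) * Uᴴ := by
      rw [hspec, hP, ← Matrix.sub_mul, ← Matrix.mul_sub, diagonal_sub]
      simp
    rw [this]
    refine PosSemidef.mul_mul_conjTranspose_same (PosSemidef.diagonal fun i => ?_) U
    simp only [Pi.zero_apply]
    exact_mod_cast sub_nonneg.2 (le_max_left _ _)
  have htrP : P.trace = ((∑ i, max (v i) 0 : ℝ) : ℂ) := by
    rw [hP, Matrix.trace_mul_comm, ← Matrix.mul_assoc, hUU, Matrix.one_mul, trace_diagonal]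
    push_cast
    rfl
  have h1 : (φ A).re ≤ ∑ i, max (v i) 0 := by
    have h2 := (hφ _ hPpos).2
    have h3 := (hφ _ hPA).1
    rw [htrP] at h2
    rw [map_sub] at h3
    have h4 := (Complex.le_def.1 h2).1
    have h5 := (Complex.le_def.1 h3).1
    simp only [Complex.ofReal_re, Complex.sub_re, Complex.zero_re] at h4 h5
    linarith
  have hsum : ∑ i, v i = 0 := by
    have h := congrArg Complex.re hA.trace_eq_sum_eigenvalues
    rw [htr, Complex.re_sum] at h
    exact h.symm
  have h2 : ∑ i, max (v i) 0 = (∑ i, v i + ∑ i, |v i|) / 2 := by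
    rw [← Finset.sum_add_distrib, Finset.sum_div]
    refine Finset.sum_congr rfl fun i _ => ?_
    rcases le_total (v i) 0 with h | h
    · rw [max_eq_right h, abs_of_nonpos h]; ring
    · rw [max_eq_left h, abs_of_nonneg h]; ring
  rw [traceNorm_eq_sum_abs_eigenvalues hA]
  rw [h2, hsum, zero_add] at h1
  exact h1

theorem IsEffect.norm_le {φ : Matrix a a ℂ →ₗ[ℂ] ℂ} (hφ : IsEffect φ) {X : Matrix a a ℂ}
    (hX : X.PosSemidef) : ‖φ X‖ ≤ X.trace.re := by
  rw [← Complex.re_eq_norm.2 (hφ X hX).1]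
  exact (Complex.le_def.1 (hφ X hX).2).1

open scoped MatrixOrder Matrix.Norms.L2Operator in
/-- The entries of a positive semidefinite matrix are bounded by its trace. -/
theorem Matrix.PosSemidef.norm_entry_le_trace {X : Matrix a a ℂ} (hX : X.PosSemidef) (p q : a) :
    ‖X p q‖ ≤ X.trace.re := by
  have hnn : ∀ i, 0 ≤ (X i i).re := fun i => (Complex.le_def.1 (hX.diag_nonneg (i := i))).1
  have hle : ∀ i, (X i i).re ≤ X.trace.re := by
    intro i
    rw [trace, Complex.re_sum]
    exact Finset.single_le_sum (f := fun i => (X i i).re) (fun i _ => hnn i) (Finset.mem_univ i)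
  -- Writing `X = B* B` makes its entries inner products of columns of `B`, to which Cauchy–Schwarz
  -- applies.
  obtain ⟨B, hB⟩ := CStarAlgebra.nonneg_iff_eq_star_mul_self.1 hX.nonneg
  have hcs : ‖X p q‖ ^ 2 ≤ (X p p).re * (X q q).re := by
    let u : a → EuclideanSpace ℂ a := fun i => WithLp.toLp 2 fun j => B j i
    have hin : ∀ i j, inner ℂ (u i) (u j) = X i j := by
      intro i j
      rw [hB]
      simp [u, PiLp.inner_apply, Matrix.mul_apply, mul_comm]
    have h := norm_inner_le_norm (𝕜 := ℂ) (u p) (u q)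
    have hsq : ∀ i, ‖u i‖ ^ 2 = (X i i).re := by
      intro i
      rw [← hin i i, inner_self_eq_norm_sq_to_K]
      norm_cast
    rw [← hsq, ← hsq, ← hin, ← mul_pow]
    exact pow_le_pow_left₀ (norm_nonneg _) h 2
  have h0 : 0 ≤ X.trace.re := (hnn p).trans (hle p)
  refine le_of_sq_le_sq ?_ h0
  calc _ ≤ _ := hcs
    _ ≤ X.trace.re * X.trace.re := mul_le_mul (hle p) (hle q) (hnn q) h0
    _ = _ := (pow_two _).symm

/-- Polarization: a map bounded by the trace on positive matrices is bounded on matrix units. -/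
theorem norm_map_single_le {V : Type*} [NormedAddCommGroup V] [NormedSpace ℂ V]
    (T : Matrix a a ℂ →ₗ[ℂ] V) (hT : ∀ X : Matrix a a ℂ, X.PosSemidef → ‖T X‖ ≤ X.trace.re)
    (p q : a) : ‖T (single p q 1)‖ ≤ 4 := by
  let v : ℂ → a → ℂ := fun w => Pi.single p 1 + w • Pi.single q 1
  let Y : ℂ → Matrix a a ℂ := fun w => vecMulVec (v w) (star (v w))
  have hsingle : ∀ p q : a, single p q (1 : ℂ) = vecMulVec (Pi.single p 1) (Pi.single q 1) := by
    intro p q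
    ext r s
    simp only [vecMulVec_apply, single_apply, Pi.single_apply, mul_ite, mul_one, mul_zero,
      eq_comm (a := r), eq_comm (a := s)]
    by_cases h1 : p = r <;> by_cases h2 : q = s <;> simp [h1, h2]
  have hstar : ∀ p : a, star (Pi.single p (1 : ℂ) : a → ℂ) = Pi.single p 1 := by
    intro p
    rw [← Pi.single_star, star_one]
  have hY : ∀ w, Y w = single p p 1 + star w • single p q 1 + w • single q p 1
      + (w * star w) • single q q 1 := by
    intro w
    simp only [Y, v, hsingle, star_add, star_smul, hstar]
    ext r s
    simp only [vecMulVec_apply, Pi.add_apply, Pi.smul_apply, Matrix.add_apply, Matrix.smul_apply,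
      smul_eq_mul]
    ring
  have htrace : ∀ p q : a, ‖(single p q (1 : ℂ)).trace‖ ≤ 1 := by
    intro p q
    by_cases h : p = q
    · subst h; simp
    · rw [trace_single_eq_of_ne p q 1 h]; simp
  have hbound : ∀ w : ℂ, ‖w‖ = 1 → ‖T (Y w)‖ ≤ 4 := by
    intro w hw
    refine (hT _ (posSemidef_vecMulVec_self_star _)).trans ((Complex.re_le_norm _).trans ?_)
    have hw' : ‖star w‖ = 1 := by rw [norm_star, hw]
    change ‖(Y w).trace‖ ≤ 4
    rw [hY]
    simp only [trace_add, trace_smul]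
    have h : (4 : ℝ) = 1 + 1 + 1 + 1 := by norm_num
    rw [h]
    refine norm_add_le_of_le (norm_add_le_of_le (norm_add_le_of_le (htrace p p) ?_) ?_) ?_ <;>
      simpa only [norm_smul, norm_mul, hw, hw', one_mul] using htrace _ _
  -- Averaging `w • Y w` over the fourth roots of unity kills every term of `hY` except the one with
  -- coefficient `star w`.
  have hsum : single p q (1 : ℂ) = (1 / 4 : ℂ) • (Y 1 + Complex.I • Y Complex.I + (-1 : ℂ) • Y (-1)
      + (-Complex.I) • Y (-Complex.I)) := by
    simp only [hY]
    ext r s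
    simp only [Matrix.add_apply, Matrix.smul_apply, smul_eq_mul, star_one, star_neg,
      Complex.star_def, Complex.conj_I]
    linear_combination (1 / 2) * (single p q (1 : ℂ) r s - single q p 1 r s) * Complex.I_sq
  rw [hsum]
  simp only [map_smul, map_add, norm_smul]
  have h1 := hbound 1 (by simp)
  have h2 := hbound (-1) (by simp)
  have h3 := hbound Complex.I (by simp)
  have h4 := hbound (-Complex.I) (by simp)
  have h5 : ‖T (Y 1) + Complex.I • T (Y Complex.I) + (-1 : ℂ) • T (Y (-1))
      + (-Complex.I) • T (Y (-Complex.I))‖ ≤ 4 + 4 + 4 + 4 := by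
    refine norm_add_le_of_le (norm_add_le_of_le (norm_add_le_of_le h1 ?_) ?_) ?_ <;>
      simpa [norm_smul]
  norm_num at h5 ⊢
  linarith

end Effects

/-! ### Channels and their perturbation. -/

section Channels

set_option linter.unusedSectionVars false

open Matrix

variable {a b c d : Type} [Fintype a] [DecidableEq a] [Fintype b] [DecidableEq b]
  [Fintype c] [DecidableEq c] [Fintype d] [DecidableEq d]

theorem linearMap_apply_eq_sum_single {V : Type*} [AddCommGroup V] [Module ℂ V]
    (T : Matrix a a ℂ →ₗ[ℂ] V) (X : Matrix a a ℂ) :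
    T X = ∑ i, ∑ j, X i j • T (Matrix.single i j 1) := by
  conv_lhs => rw [matrix_eq_sum_single X]
  simp only [map_sum, ← map_smul, smul_single, smul_eq_mul, mul_one]

theorem norm_map_le_of_norm_single_le {V : Type*} [NormedAddCommGroup V] [NormedSpace ℂ V]
    (T : Matrix a a ℂ →ₗ[ℂ] V) {X : Matrix a a ℂ} {m t : ℝ} (hX : ∀ i j, ‖X i j‖ ≤ m)
    (hT : ∀ i j, ‖T (single i j 1)‖ ≤ t) :
    ‖T X‖ ≤ (Fintype.card a : ℝ) ^ 2 * (m * t) := by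
  rw [linearMap_apply_eq_sum_single T X]
  calc _ ≤ ∑ _i : a, ∑ _j : a, m * t := by
        refine norm_sum_le_of_le _ fun i _ => norm_sum_le_of_le _ fun j _ => ?_
        rw [norm_smul]
        exact mul_le_mul (hX i j) (hT i j) (norm_nonneg _) ((norm_nonneg _).trans (hX i j))
    _ = _ := by simp; ring

/-- The entry `X p q`, as a linear functional. -/
def entryFunctional (p q : a) : Matrix a a ℂ →ₗ[ℂ] ℂ where
  toFun X := X p q
  map_add' _ _ := rfl
  map_smul' _ _ := rfl

theorem isEffect_entryFunctional (p : a) : IsEffect (entryFunctional p p) := by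
  intro X hX
  refine ⟨hX.diag_nonneg, ?_⟩
  exact Finset.single_le_sum (f := fun i => X i i) (fun i _ => hX.diag_nonneg) (Finset.mem_univ p)

/-- Heisenberg picture: whatever follows the channel under study is absorbed into a single effect.
-/
theorem IsEffect.comp {φ : Matrix b b ℂ →ₗ[ℂ] ℂ} (hφ : IsEffect φ)
    {T : Matrix a a ℂ →ₗ[ℂ] Matrix b b ℂ} (hpos : ∀ X, X.PosSemidef → (T X).PosSemidef)
    (htr : ∀ X, (T X).trace = X.trace) : IsEffect (φ ∘ₗ T) := by
  intro X hX
  rw [← htr X]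
  exact hφ _ (hpos X hX)

theorem IsEffect.norm_map_le {φ : Matrix a a ℂ →ₗ[ℂ] ℂ} (hφ : IsEffect φ) {X : Matrix a a ℂ}
    {m : ℝ} (hX : ∀ i j, ‖X i j‖ ≤ m) : ‖φ X‖ ≤ (Fintype.card a : ℝ) ^ 2 * (m * 4) :=
  norm_map_le_of_norm_single_le φ hX fun i j => norm_map_single_le φ (fun _ h => hφ.norm_le h) i j

/-- Complete positivity is defined with references `Fin k`; relabelling the basis extends it to any
finite reference. -/
theorem IsChannel.posSemidef_idTensor {T : Matrix a a ℂ →ₗ[ℂ] Matrix b b ℂ} (hT : IsChannel T)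
    {X : Matrix (c × a) (c × a) ℂ} (hX : X.PosSemidef) : (idTensor c T X).PosSemidef := by
  let e := Fintype.equivFin c
  have h := (hT.1 _ _ (hX.submatrix (Prod.map e.symm id))).submatrix (Prod.map e id)
  convert h using 1
  ext p q
  simp [idTensor]

theorem IsChannel.trace_idTensor {T : Matrix a a ℂ →ₗ[ℂ] Matrix b b ℂ} (hT : IsChannel T)
    (X : Matrix (c × a) (c × a) ℂ) : (idTensor c T X).trace = X.trace := by
  simp only [trace, Fintype.sum_prod_type]
  exact Finset.sum_congr rfl fun i _ => hT.2 (of fun k l => X (i, k) (i, l))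

theorem IsChannel.posSemidef_tensorId {T : Matrix a a ℂ →ₗ[ℂ] Matrix b b ℂ} (hT : IsChannel T)
    {X : Matrix (a × c) (a × c) ℂ} (hX : X.PosSemidef) : (tensorId c T X).PosSemidef :=
  (hT.posSemidef_idTensor (hX.submatrix Prod.swap)).submatrix Prod.swap

theorem IsChannel.trace_tensorId {T : Matrix a a ℂ →ₗ[ℂ] Matrix b b ℂ} (hT : IsChannel T)
    (X : Matrix (a × c) (a × c) ℂ) : (tensorId c T X).trace = X.trace := by
  simp only [trace, Fintype.sum_prod_type_right]
  exact Finset.sum_congr rfl fun i _ => hT.2 (of fun k l => X (k, i) (l, i))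

theorem IsChannel.posSemidef {T : Matrix a a ℂ →ₗ[ℂ] Matrix b b ℂ} (hT : IsChannel T)
    {X : Matrix a a ℂ} (hX : X.PosSemidef) : (T X).PosSemidef :=
  (hT.posSemidef_idTensor (c := Unit) (hX.submatrix Prod.snd)).submatrix fun i => ((), i)

/-- The entries of the images of matrix units under a channel are uniformly bounded. -/
theorem IsChannel.norm_single_apply_le {T : Matrix a a ℂ →ₗ[ℂ] Matrix b b ℂ} (hT : IsChannel T)
    (i j : a) (p q : b) : ‖T (single i j 1) p q‖ ≤ 4 :=
  norm_map_single_le (entryFunctional p q ∘ₗ T)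
    (fun X hX => hT.2 X ▸ (hT.posSemidef hX).norm_entry_le_trace p q) i j

/-- Local maps on different systems commute. -/
theorem tensorMap_eq_idTensor_comp_tensorId (T : Matrix a a ℂ →ₗ[ℂ] Matrix b b ℂ)
    (S : Matrix c c ℂ →ₗ[ℂ] Matrix d d ℂ) :
    tensorMap T S = idTensor b S ∘ₗ tensorId c T := by
  refine LinearMap.ext fun X => ?_
  ext p q
  change (entryFunctional p.1 q.1 ∘ₗ T) (of fun i j =>
      (entryFunctional p.2 q.2 ∘ₗ S) (of fun k l => X (i, k) (j, l))) =
    (entryFunctional p.2 q.2 ∘ₗ S) (of fun k l =>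
      (entryFunctional p.1 q.1 ∘ₗ T) (of fun i j => X (i, k) (j, l)))
  set t := entryFunctional p.1 q.1 ∘ₗ T
  set s := entryFunctional p.2 q.2 ∘ₗ S
  -- With the output entries fixed, two scalar functionals on the two factors must be interchanged;
  -- expanding `s` in matrix units reduces this to linearity of `t`.
  have h : (of fun i j => s (of fun k l => X (i, k) (j, l))) =
      ∑ k, ∑ l, s (single k l 1) • of fun i j => X (i, k) (j, l) := by
    ext i j
    rw [of_apply, linearMap_apply_eq_sum_single s]
    simp only [Matrix.sum_apply, Matrix.smul_apply, of_apply, smul_eq_mul, mul_comm]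
  rw [h, linearMap_apply_eq_sum_single s]
  simp only [map_sum, map_smul, of_apply, smul_eq_mul, mul_comm]

/-- Applying channels with close matrix entries to one part of a state gives outcome probabilities
that are close, whatever is done afterwards. -/
theorem IsEffect.norm_idTensor_sub_le {φ : Matrix (c × b) (c × b) ℂ →ₗ[ℂ] ℂ} (hφ : IsEffect φ)
    {T S : Matrix a a ℂ →ₗ[ℂ] Matrix b b ℂ} {X : Matrix (c × a) (c × a) ℂ} {η : ℝ}
    (hX : ∀ i j, ‖X i j‖ ≤ 1)
    (hTS : ∀ i j p q, ‖T (single i j 1) p q - S (single i j 1) p q‖ ≤ η) :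
    ‖φ (idTensor c T X) - φ (idTensor c S X)‖ ≤
      4 * (Fintype.card a * (Fintype.card c * Fintype.card b) : ℝ) ^ 2 * η := by
  rw [← map_sub]
  -- Each output entry is a sum of `(card a)²` terms of size at most `η`; `φ` then costs four times
  -- the squared output dimension.
  refine (hφ.norm_map_le (m := (Fintype.card a : ℝ) ^ 2 * (1 * η)) fun p q => ?_).trans_eq ?_
  · have := norm_map_le_of_norm_single_le (entryFunctional p.2 q.2 ∘ₗ (T - S))
      (X := of fun i j => X (p.1, i) (q.1, j)) (fun i j => hX _ _) (fun i j => hTS i j p.2 q.2)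
    exact this
  · rw [Fintype.card_prod]; push_cast; ring

theorem IsEffect.norm_tensorId_sub_le {φ : Matrix (b × c) (b × c) ℂ →ₗ[ℂ] ℂ} (hφ : IsEffect φ)
    {T S : Matrix a a ℂ →ₗ[ℂ] Matrix b b ℂ} {X : Matrix (a × c) (a × c) ℂ} {η : ℝ}
    (hX : ∀ i j, ‖X i j‖ ≤ 1)
    (hTS : ∀ i j p q, ‖T (single i j 1) p q - S (single i j 1) p q‖ ≤ η) :
    ‖φ (tensorId c T X) - φ (tensorId c S X)‖ ≤
      4 * (Fintype.card a * (Fintype.card b * Fintype.card c) : ℝ) ^ 2 * η := by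
  rw [← map_sub]
  refine (hφ.norm_map_le (m := (Fintype.card a : ℝ) ^ 2 * (1 * η)) fun p q => ?_).trans_eq ?_
  · have := norm_map_le_of_norm_single_le (entryFunctional p.1 q.1 ∘ₗ (T - S))
      (X := of fun i j => X (i, p.2) (j, q.2)) (fun i j => hX _ _) (fun i j => hTS i j p.1 q.1)
    exact this
  · rw [Fintype.card_prod]; push_cast; ring

theorem isDensity_single (i : a) : IsDensity (single i i (1 : ℂ)) := by
  refine ⟨?_, by simp⟩
  rw [← diagonal_single]
  refine PosSemidef.diagonal fun j => ?_
  by_cases h : j = i <;> simp [h]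

theorem IsDensity.appendState {L R : Type} [Fintype L] [DecidableEq L] [Fintype R] [DecidableEq R]
    {Ψ : Matrix (L × R) (L × R) ℂ} (hΨ : IsDensity Ψ) {ρ : Matrix a a ℂ} (hρ : IsDensity ρ) :
    IsDensity (appendState a Ψ ρ) := by
  refine ⟨(hρ.1.kronecker hΨ.1).submatrix _, ?_⟩
  have h : (ρ ⊗ₖ Ψ).trace = 1 := by rw [trace_kronecker, hρ.2, hΨ.2, one_mul]
  rw [← h]
  exact (Equiv.prodAssoc a L R).sum_comp (fun p => (ρ ⊗ₖ Ψ) p p)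

theorem IsDensity.norm_entry_le_one {ρ : Matrix a a ℂ} (hρ : IsDensity ρ) (p q : a) :
    ‖ρ p q‖ ≤ 1 := by
  simpa [hρ.2] using hρ.1.norm_entry_le_trace p q

theorem traceNorm_sub_comm (A B : Matrix a a ℂ) : traceNorm (A - B) = traceNorm (B - A) := by
  have h : (A - B)ᴴ * (A - B) = (B - A)ᴴ * (B - A) := by
    rw [← neg_sub B A, conjTranspose_neg, neg_mul_neg]
  simp only [traceNorm, h]

theorem diamondDist_comm (T S : Matrix a a ℂ →ₗ[ℂ] Matrix b b ℂ) :
    diamondDist T S = diamondDist S T := by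
  simp only [diamondDist, traceNorm_sub_comm]

/-- Outcome probabilities of two channels on the same input differ by at most half of their
diamond distance. -/
theorem IsEffect.re_sub_le_of_diamondDist_le {φ : Matrix b b ℂ →ₗ[ℂ] ℂ} (hφ : IsEffect φ)
    {T S : Matrix a a ℂ →ₗ[ℂ] Matrix b b ℂ} {r : ℝ} (hr : 0 ≤ r)
    (h : diamondDist T S ≤ ENNReal.ofReal r) {ρ : Matrix a a ℂ} (hρ : IsDensity ρ)
    (hT : IsDensity (T ρ)) (hS : IsDensity (S ρ)) :
    (φ (T ρ)).re - (φ (S ρ)).re ≤ r / 2 := by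
  -- A one-dimensional reference suffices: the argument never uses entanglement with the secret.
  let ω : Matrix (Fin 1 × a) (Fin 1 × a) ℂ := ρ.submatrix Prod.snd Prod.snd
  have hω : IsDensity ω := by
    refine ⟨hρ.1.submatrix _, ?_⟩
    rw [← hρ.2]
    simp [ω, trace, Fintype.sum_prod_type]
  have h1 : ENNReal.ofReal (traceNorm (idTensor (Fin 1) T ω - idTensor (Fin 1) S ω)) ≤
      ENNReal.ofReal r := by
    refine le_trans (le_iSup_of_le 1 ?_) h
    exact le_iSup₂ (f := fun (ω : Matrix (Fin 1 × a) (Fin 1 × a) ℂ) (_ : IsDensity ω) =>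
      ENNReal.ofReal (traceNorm (idTensor (Fin 1) T ω - idTensor (Fin 1) S ω))) ω hω
  have h2 := (ENNReal.ofReal_le_ofReal_iff hr).1 h1
  let ι : b → Fin 1 × b := fun i => (0, i)
  let restrict : Matrix (Fin 1 × b) (Fin 1 × b) ℂ →ₗ[ℂ] Matrix b b ℂ :=
    { toFun := fun X => X.submatrix ι ι, map_add' := fun _ _ => rfl, map_smul' := fun _ _ => rfl }
  have hψ : IsEffect (φ ∘ₗ restrict) :=
    hφ.comp (fun X hX => hX.submatrix ι) fun X => by
      change ∑ i, X (0, i) (0, i) = ∑ p, X p p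
      simp [Fintype.sum_prod_type]
  have hTω : idTensor (Fin 1) T ω = (T ρ).submatrix Prod.snd Prod.snd := rfl
  have hSω : idTensor (Fin 1) S ω = (S ρ).submatrix Prod.snd Prod.snd := rfl
  have h3 := hψ.re_le_half_traceNorm (A := idTensor (Fin 1) T ω - idTensor (Fin 1) S ω)
    (by
      rw [hTω, hSω]
      exact ((hT.1.submatrix _).isHermitian).sub (hS.1.submatrix _).isHermitian)
    (by
      have : ∀ X : Matrix b b ℂ, (X.submatrix (Prod.snd : Fin 1 × b → b) Prod.snd).trace = X.trace :=
        fun X => by simp [trace, Fintype.sum_prod_type]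
      rw [trace_sub, hTω, hSω, this, this, hT.2, hS.2, sub_self])
  have h4 : (φ ∘ₗ restrict) (idTensor (Fin 1) T ω - idTensor (Fin 1) S ω) = φ (T ρ) - φ (S ρ) := by
    rw [map_sub]; rfl
  rw [h4, Complex.sub_re] at h3
  linarith

end Channels

/-! ### One-way protocols from rounded parameters. -/

section OneWay

/-- A code of the sender's inputs that determines the function is a one-way protocol. -/
theorem oneWayAB_zero_le_of_code {n c : ℕ} {κ : Type*} [Fintype κ] (hκ : Fintype.card κ = 2 ^ c)
    (f : BitString n → BitString n → Bool) (code : BitString n → κ)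
    (h : ∀ u u', code u = code u' → f u = f u') : oneWayAB 0 f ≤ c := by
  have e : κ ≃ BitString c := Fintype.equivOfCardEq (by simp [hκ])
  let msg : BitString n → BitString c := fun u => e (code u)
  -- The receiver evaluates `f` at any input with the same message.
  let decode : BitString c → BitString n := Function.invFun msg
  have hdec : ∀ u, f (decode (msg u)) = f u := fun u =>
    h _ _ (e.injective (Function.invFun_eq (f := msg) ⟨u, rfl⟩))
  refine Nat.sInf_le ⟨⟨fun u => PMF.pure (msg u), fun v m => PMF.pure (f (decode m) v)⟩, ?_⟩
  intro u v
  simp [PMF.pure_bind, hdec]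

/-- Rounding of a bounded real number to `k + 5` bits. -/
theorem exists_rounding (k : ℕ) : ∃ r : ℝ → Fin (2 ^ (k + 5)), ∀ x y : ℝ, |x| ≤ 4 → |y| ≤ 4 →
    r x = r y → |x - y| ≤ (1 / 2) ^ (k + 1) := by
  -- The offset `4 * 2 ^ (k + 1)` makes the value nonnegative on `[-4, 4]`. The endpoint `4` gives
  -- `2 ^ (k + 4)` itself, hence `k + 5` bits.
  let z : ℝ → ℤ := fun x => ⌊x * 2 ^ (k + 1)⌋ + 2 ^ (k + 3)
  have hpos : (0 : ℝ) < 2 ^ (k + 1) := by positivity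
  have hp : (2 : ℝ) ^ (k + 3) = 4 * 2 ^ (k + 1) := by ring
  have hz : ∀ x : ℝ, |x| ≤ 4 → 0 ≤ z x ∧ z x < 2 ^ (k + 5) := by
    intro x hx
    obtain ⟨h1, h2⟩ := abs_le.1 hx
    constructor
    · have : (-2 ^ (k + 3) : ℤ) ≤ ⌊x * 2 ^ (k + 1)⌋ := by
        rw [Int.le_floor]
        push_cast
        rw [hp]
        nlinarith
      simp only [z]
      linarith
    · have : (⌊x * 2 ^ (k + 1)⌋ : ℝ) ≤ 2 ^ (k + 3) := by
        refine (Int.floor_le _).trans ?_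
        rw [hp]
        nlinarith
      have h3 : ⌊x * 2 ^ (k + 1)⌋ ≤ (2 : ℤ) ^ (k + 3) := by exact_mod_cast this
      have h4 : (2 : ℤ) ^ (k + 5) = 4 * 2 ^ (k + 3) := by ring
      have h5 : (0 : ℤ) < 2 ^ (k + 3) := by positivity
      simp only [z]
      linarith
  refine ⟨fun x => ⟨(z x).toNat % 2 ^ (k + 5), Nat.mod_lt _ (by positivity)⟩, ?_⟩
  intro x y hx hy hxy
  have hlt : ∀ x : ℝ, |x| ≤ 4 → (z x).toNat < 2 ^ (k + 5) := by
    intro x hx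
    rw [Int.toNat_lt (hz x hx).1]
    exact_mod_cast (hz x hx).2
  have h1 : (z x).toNat = (z y).toNat := by
    have := Fin.ext_iff.1 hxy
    simpa only [Nat.mod_eq_of_lt (hlt x hx), Nat.mod_eq_of_lt (hlt y hy)] using this
  have h2 : z x = z y := by
    rw [← Int.toNat_of_nonneg (hz x hx).1, ← Int.toNat_of_nonneg (hz y hy).1, h1]
  have h3 : ⌊x * 2 ^ (k + 1)⌋ = ⌊y * 2 ^ (k + 1)⌋ := add_right_cancel h2
  have h4 := Int.abs_sub_lt_one_of_floor_eq_floor h3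
  rw [← sub_mul, abs_mul, abs_of_pos hpos] at h4
  rw [one_div, inv_pow, ← one_div, le_div_iff₀ hpos]
  exact h4.le

/-- If the function is determined by bounded complex parameters of the sender up to precision
`2 ^ (-k)`, the rounded parameters are a sufficient message. -/
theorem oneWayAB_zero_le_of_parameters {n k : ℕ} {ι : Type*} [Fintype ι]
    (f : BitString n → BitString n → Bool) (g : BitString n → ι → ℂ) (hg : ∀ u i, ‖g u i‖ ≤ 4)
    (h : ∀ u u', (∀ i, ‖g u i - g u' i‖ ≤ (1 / 2) ^ k) → f u = f u') :
    oneWayAB 0 f ≤ 2 * (k + 5) * Fintype.card ι := by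
  classical
  obtain ⟨r, hr⟩ := exists_rounding k
  refine oneWayAB_zero_le_of_code (κ := ι → Fin (2 ^ (k + 5)) × Fin (2 ^ (k + 5))) ?_ f
    (fun u i => (r (g u i).re, r (g u i).im)) ?_
  · rw [Fintype.card_fun, Fintype.card_prod, Fintype.card_fin, ← pow_add, ← pow_mul]
    ring_nf
  · intro u u' huu
    refine h u u' fun i => ?_
    have hi := congrFun huu i
    have hre := hr _ _ ((Complex.abs_re_le_norm _).trans (hg u i))
      ((Complex.abs_re_le_norm _).trans (hg u' i)) (congrArg Prod.fst hi)
    have him := hr _ _ ((Complex.abs_im_le_norm _).trans (hg u i))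
      ((Complex.abs_im_le_norm _).trans (hg u' i)) (congrArg Prod.snd hi)
    refine (Complex.norm_le_abs_re_add_abs_im _).trans ?_
    rw [Complex.sub_re, Complex.sub_im]
    calc _ ≤ (1 / 2 : ℝ) ^ (k + 1) + (1 / 2) ^ (k + 1) := add_le_add hre him
      _ = _ := by ring

end OneWay

/-! ### Separation of disclosed from hidden inputs, and its stability. -/

namespace CDQSProtocol

open Matrix

variable {n dQ E qA qB : ℕ}

theorem isDensity_encode (P : CDQSProtocol n dQ E qA qB) (x y : BitString n)
    {ρ : Matrix (Fin dQ) (Fin dQ) ℂ} (hρ : IsDensity ρ) : IsDensity (P.encode x y ρ) := by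
  have h := P.resource_isDensity.appendState hρ
  refine ⟨(P.alice_isChannel x).posSemidef_tensorId ((P.bob_isChannel y).posSemidef_idTensor h.1),
    ?_⟩
  exact ((P.alice_isChannel x).trace_tensorId _).trans
    (((P.bob_isChannel y).trace_idTensor _).trans h.2)

/-- Inputs on which the secret is disclosed and inputs on which it is hidden are told apart by
decoding a suitable basis state of the secret. -/
theorem exists_effect_separating (P : CDQSProtocol n dQ E qA qB) (hdQ : 0 < dQ)
    {f : BitString n → BitString n → Bool} {ε δ : ℝ} (hε : 0 ≤ ε) (hδ : 0 ≤ δ)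
    (hcor : P.IsCorrect f ε) (hsec : P.IsSecure f δ) {x y x' y' : BitString n}
    (h1 : f x y = true) (h0 : f x' y' = false) :
    ∃ (i : Fin dQ) (φ : Matrix (Qubits qA × Qubits qB) (Qubits qA × Qubits qB) ℂ →ₗ[ℂ] ℂ),
      IsEffect φ ∧ 1 - 1 / (dQ : ℝ) - (ε + δ) / 2 ≤
        ‖φ (P.encode x y (single i i 1)) - φ (P.encode x' y' (single i i 1))‖ := by
  obtain ⟨D, hD, hDdist⟩ := hcor x y h1
  obtain ⟨S, hS, hSdist⟩ := hsec x' y' h0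
  have hσ : IsDensity (S (1 : Matrix Unit Unit ℂ)) :=
    ⟨hS.posSemidef PosSemidef.one, by rw [hS.2]; simp⟩
  set σ := S (1 : Matrix Unit Unit ℂ) with hσdef
  have hDσ : ∑ i, (D σ i i).re = 1 := by
    have h := congrArg Complex.re ((hD.2 σ).trans hσ.2)
    rwa [trace, Complex.re_sum] at h
  -- The `dQ` outcome probabilities sum to `1`, so one is at most their average.
  obtain ⟨i, hi⟩ : ∃ i, (D σ i i).re ≤ 1 / (dQ : ℝ) := by
    by_contra! hcon
    have : Nonempty (Fin dQ) := ⟨⟨0, hdQ⟩⟩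
    have h := Finset.sum_lt_sum_of_nonempty Finset.univ_nonempty fun i _ => hcon i
    rw [hDσ] at h
    have : (dQ : ℝ) ≠ 0 := by positivity
    simp [this] at h
  have hρ := isDensity_single i
  have heff := isEffect_entryFunctional i
  have hφ : IsEffect (entryFunctional i i ∘ₗ D) :=
    heff.comp (fun _ h => hD.posSemidef h) hD.2
  refine ⟨i, entryFunctional i i ∘ₗ D, hφ, ?_⟩
  have henc := P.isDensity_encode x y hρ
  have hS1 : (S ∘ₗ traceOut (Fin dQ)) (single i i 1) = σ := by
    rw [hσdef, LinearMap.comp_apply]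
    congr 1
    ext
    simp [traceOut]
  have hA := heff.re_sub_le_of_diamondDist_le (T := LinearMap.id) (S := D ∘ₗ P.encode x y) hε
    (by rwa [diamondDist_comm]) hρ hρ ⟨hD.posSemidef henc.1, (hD.2 _).trans henc.2⟩
  have hB := hφ.re_sub_le_of_diamondDist_le (T := P.encode x' y') (S := S ∘ₗ traceOut (Fin dQ)) hδ
    (by rwa [diamondDist_comm]) hρ (P.isDensity_encode x' y' hρ) (by rwa [hS1])
  rw [hS1] at hB
  refine le_trans ?_ (Complex.re_le_norm _)
  rw [Complex.sub_re]
  have hC : (entryFunctional i i (LinearMap.id (R := ℂ) (single i i (1 : ℂ)))).re = 1 := by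
    change (single i i (1 : ℂ) i i).re = 1
    simp
  have hE : ((entryFunctional i i ∘ₗ D) σ).re ≤ 1 / (dQ : ℝ) := hi
  rw [hC] at hA
  have hF : entryFunctional i i ((D ∘ₗ P.encode x y) (single i i 1)) =
    (entryFunctional i i ∘ₗ D) (P.encode x y (single i i 1)) := rfl
  rw [hF] at hA
  linarith

/-- If Bob's channels agree up to a small error, so does the function. -/
theorem eq_of_bob_close (P : CDQSProtocol n dQ E qA qB) (hdQ : 0 < dQ)
    {f : BitString n → BitString n → Bool} {ε δ η : ℝ} (hε : 0 ≤ ε) (hδ : 0 ≤ δ)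
    (hcor : P.IsCorrect f ε) (hsec : P.IsSecure f δ) {y y' : BitString n}
    (hclose : ∀ i j p q, ‖P.bob y (single i j 1) p q - P.bob y' (single i j 1) p q‖ ≤ η)
    (hη : 4 * (dQ * 2 ^ (2 * E + qB) : ℝ) ^ 2 * η < 1 - 1 / (dQ : ℝ) - (ε + δ) / 2)
    (x : BitString n) : f x y = f x y' := by
  have key : ∀ z z' : BitString n, f x z = true → f x z' = false →
      (∀ i j p q, ‖P.bob z (single i j 1) p q - P.bob z' (single i j 1) p q‖ ≤ η) → False := by
    intro z z' h1 h0 hzz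
    obtain ⟨i, φ, hφ, hsep⟩ := P.exists_effect_separating hdQ hε hδ hcor hsec h1 h0
    have hψ : IsEffect (φ ∘ₗ tensorId (Qubits qB) (P.alice x)) :=
      hφ.comp (fun _ h => (P.alice_isChannel x).posSemidef_tensorId h)
        (P.alice_isChannel x).trace_tensorId
    have h := hψ.norm_idTensor_sub_le
      (X := appendState (Fin dQ) P.resource (single i i 1))
      (P.resource_isDensity.appendState (isDensity_single i)).norm_entry_le_one hzz
    have h2 := hsep.trans h
    simp only [Fintype.card_prod, Fintype.card_fin, Fintype.card_fun, Fintype.card_bool] at h2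
    push_cast at h2
    ring_nf at h2 hη
    linarith
  cases h : f x y <;> cases h' : f x y'
  · rfl
  · exact (key y' y h' h fun i j p q => norm_sub_rev (P.bob y (single i j 1) p q) _ ▸
      hclose i j p q).elim
  · exact (key y y' h h' hclose).elim
  · rfl

/-- If Alice's channels agree up to a small error, so does the function. -/
theorem eq_of_alice_close (P : CDQSProtocol n dQ E qA qB) (hdQ : 0 < dQ)
    {f : BitString n → BitString n → Bool} {ε δ η : ℝ} (hε : 0 ≤ ε) (hδ : 0 ≤ δ)
    (hcor : P.IsCorrect f ε) (hsec : P.IsSecure f δ) {x x' : BitString n}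
    (hclose : ∀ i j p q, ‖P.alice x (single i j 1) p q - P.alice x' (single i j 1) p q‖ ≤ η)
    (hη : 4 * (dQ * 2 ^ (2 * E + qA) : ℝ) ^ 2 * η < 1 - 1 / (dQ : ℝ) - (ε + δ) / 2)
    (y : BitString n) : f x y = f x' y := by
  have key : ∀ z z' : BitString n, f z y = true → f z' y = false →
      (∀ i j p q, ‖P.alice z (single i j 1) p q - P.alice z' (single i j 1) p q‖ ≤ η) →
      False := by
    intro z z' h1 h0 hzz
    obtain ⟨i, φ, hφ, hsep⟩ := P.exists_effect_separating hdQ hε hδ hcor hsec h1 h0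
    have hψ : IsEffect (φ ∘ₗ idTensor (Qubits qA) (P.bob y)) :=
      hφ.comp (fun _ h => (P.bob_isChannel y).posSemidef_idTensor h)
        (P.bob_isChannel y).trace_idTensor
    have h := hψ.norm_tensorId_sub_le
      (X := appendState (Fin dQ) P.resource (single i i 1))
      (P.resource_isDensity.appendState (isDensity_single i)).norm_entry_le_one hzz
    -- `tensorMap` applies Bob's map first; commuting the two lets Alice's act directly on the
    -- initial state, with Bob's absorbed in `ψ`.
    simp only [encode, tensorMap_eq_idTensor_comp_tensorId] at hsep
    have h2 := hsep.trans h
    simp only [Fintype.card_prod, Fintype.card_fin, Fintype.card_fun, Fintype.card_bool] at h2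
    push_cast at h2
    ring_nf at h2 hη
    linarith
  cases h : f x y <;> cases h' : f x' y
  · rfl
  · exact (key x' x h' h fun i j p q => norm_sub_rev (P.alice x (single i j 1) p q) _ ▸
      hclose i j p q).elim
  · exact (key x x' h h' hclose).elim
  · rfl

end CDQSProtocol

/-! ### Logarithms and the final count. -/

/-- Taking logarithms in a bound `R ≤ K (q + E + 2) 4 ^ (q + E)`. -/
theorem half_logb_le_of_le {R K q E : ℕ} (hK : 1 ≤ K)
    (hR : R ≤ K * (q + E + 2) * 4 ^ (q + E)) :
    (q : ℝ) + E ≥ 1 / 2 * Real.logb 2 R - Real.logb 2 (2 * K) * Real.logb 2 ((q : ℝ) + E + 2) := by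
  have hK' : (1 : ℝ) ≤ K := by exact_mod_cast hK
  have hs : (2 : ℝ) ≤ (q : ℝ) + E + 2 := le_add_of_nonneg_left (by positivity)
  set s : ℝ := (q : ℝ) + E + 2
  have hlogK : 0 ≤ Real.logb 2 K := Real.logb_nonneg (by norm_num) hK'
  -- The shift by `2` in `s` gives this, so the additive constant `logb 2 K` is absorbed into a
  -- multiple of `logb 2 s`.
  have hlogs : 1 ≤ Real.logb 2 s := by
    rw [Real.le_logb_iff_rpow_le (by norm_num) (by linarith)]
    simpa using hs
  have hlog : Real.logb 2 (K * s * 4 ^ (q + E)) =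
      Real.logb 2 K + Real.logb 2 s + 2 * ((q : ℝ) + E) := by
    have h4 : (4 : ℝ) ^ (q + E) = 2 ^ (2 * (q + E)) := by rw [pow_mul]; norm_num
    rw [h4, Real.logb_mul (by positivity) (by positivity), Real.logb_mul (by positivity)
      (by positivity), Real.logb_pow, Real.logb_self_eq_one (by norm_num)]
    push_cast
    ring
  have hRlog : Real.logb 2 R ≤ Real.logb 2 K + Real.logb 2 s + 2 * ((q : ℝ) + E) := by
    rcases Nat.eq_zero_or_pos R with h | h
    · rw [h, Nat.cast_zero, Real.logb_zero]
      positivity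
    · rw [← hlog]
      refine Real.logb_le_logb_of_le (by norm_num) (by exact_mod_cast h) ?_
      have h' : (R : ℝ) ≤ K * ((q : ℝ) + E + 2) * 4 ^ (q + E) := by exact_mod_cast hR
      exact h'
  rw [Real.logb_mul (by norm_num) (by positivity), Real.logb_self_eq_one (by norm_num)]
  nlinarith

theorem mainTheorem1 (dQ : ℕ) (hdQ : 2 ≤ dQ) (ε δ : ℝ) (hε : 0 ≤ ε) (hδ : 0 ≤ δ)
    (hεδ : ε + δ < 2 * (1 - 1 / Real.sqrt dQ)) :
    ∃ C : ℝ, ∀ (n E qA qB : ℕ) (f : BitString n → BitString n → Bool)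
      (P : CDQSProtocol n dQ E qA qB), P.IsCorrect f ε → P.IsSecure f δ →
        ((qB : ℝ) + E ≥ 1 / 2 * Real.logb 2 (oneWayBA 0 f) - C * Real.logb 2 ((qB : ℝ) + E + 2)) ∧
        ((qA : ℝ) + E ≥ 1 / 2 * Real.logb 2 (oneWayAB 0 f) - C * Real.logb 2 ((qA : ℝ) + E + 2)) := by
  have hd : (2 : ℝ) ≤ dQ := by exact_mod_cast hdQ
  -- Only the weaker condition with `1 / dQ` in place of `1 / √dQ` is needed.
  have hgap : 0 < 1 - 1 / (dQ : ℝ) - (ε + δ) / 2 := by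
    have h : 1 / (dQ : ℝ) ≤ 1 / Real.sqrt dQ :=
      one_div_le_one_div_of_le (Real.sqrt_pos.2 (by linarith))
        (Real.sqrt_le_left (by linarith) |>.2 (by nlinarith))
    linarith
  obtain ⟨k₀, hk₀⟩ : ∃ k₀ : ℕ, 4 * (dQ : ℝ) ^ 2 * (1 / 2) ^ k₀ <
      1 - 1 / (dQ : ℝ) - (ε + δ) / 2 := by
    obtain ⟨k₀, h⟩ := exists_pow_lt_of_lt_one (y := (1 / 2 : ℝ))
      (div_pos hgap (show 0 < 4 * (dQ : ℝ) ^ 2 by positivity)) (by norm_num)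
    exact ⟨k₀, by rwa [lt_div_iff₀' (by positivity)] at h⟩
  -- With `m = 2 * E + q`, `2 * m` bits cancel the dimension factor; the remaining `k₀` bits depend
  -- only on `ε`, `δ`, `dQ`.
  have hprec : ∀ m : ℕ, 4 * (dQ * 2 ^ m : ℝ) ^ 2 * (1 / 2) ^ (2 * m + k₀) <
      1 - 1 / (dQ : ℝ) - (ε + δ) / 2 := by
    intro m
    refine lt_of_eq_of_lt ?_ hk₀
    have : ((2 : ℝ) ^ m) ^ 2 * (1 / 2) ^ (2 * m) = 1 := by
      rw [← pow_mul, mul_comm m 2, ← mul_pow]; norm_num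
    rw [pow_add, mul_pow]
    linear_combination 4 * (dQ : ℝ) ^ 2 * (1 / 2) ^ k₀ * this
  -- The factor `dQ ^ 2` is for Alice, whose channel also takes in the secret; Bob's bound does not
  -- need it.
  have hK : 1 ≤ 2 * dQ ^ 2 * (k₀ + 5) :=
    Nat.succ_le_of_lt (by positivity)
  have hbits : ∀ q E : ℕ, 2 * (2 * (2 * E + q) + k₀ + 5) ≤ 2 * (k₀ + 5) * (q + E + 2) := by
    intro q E
    nlinarith
  refine ⟨Real.logb 2 (2 * (2 * dQ ^ 2 * (k₀ + 5) : ℕ)), fun n E qA qB f P hcor hsec => ⟨?_, ?_⟩⟩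
  · refine half_logb_le_of_le hK ?_
    have h := oneWayAB_zero_le_of_parameters (k := 2 * (2 * E + qB) + k₀)
      (ι := (Qubits E × Qubits E) × (Qubits qB × Qubits qB)) (fun y x => f x y)
      (fun y t => P.bob y (Matrix.single t.1.1 t.1.2 1) t.2.1 t.2.2)
      (fun y t => (P.bob_isChannel y).norm_single_apply_le _ _ _ _)
      fun y y' hclose => funext fun x =>
        P.eq_of_bob_close (by omega) hε hδ hcor hsec
          (fun i j p q => hclose ((i, j), (p, q))) (hprec _) x
    have hcard : Fintype.card ((Qubits E × Qubits E) × (Qubits qB × Qubits qB)) =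
        4 ^ (qB + E) := by
      simp only [Fintype.card_prod, Fintype.card_fun, Fintype.card_bool, Fintype.card_fin,
        ← mul_pow, ← pow_add]
      norm_num [pow_add, mul_comm]
    rw [hcard] at h
    refine h.trans (Nat.mul_le_mul_right _ ((hbits qB E).trans ?_))
    have : 1 ≤ dQ ^ 2 := Nat.one_le_pow _ _ (by omega)
    exact Nat.mul_le_mul_right _ (Nat.mul_le_mul_right _ (by omega))
  · refine half_logb_le_of_le hK ?_
    have h := oneWayAB_zero_le_of_parameters (k := 2 * (2 * E + qA) + k₀)
      (ι := ((Fin dQ × Qubits E) × (Fin dQ × Qubits E)) × (Qubits qA × Qubits qA)) f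
      (fun x t => P.alice x (Matrix.single t.1.1 t.1.2 1) t.2.1 t.2.2)
      (fun x t => (P.alice_isChannel x).norm_single_apply_le _ _ _ _)
      fun x x' hclose => funext fun y =>
        P.eq_of_alice_close (by omega) hε hδ hcor hsec
          (fun i j p q => hclose ((i, j), (p, q))) (hprec _) y
    have hcard : Fintype.card (((Fin dQ × Qubits E) × (Fin dQ × Qubits E)) ×
        (Qubits qA × Qubits qA)) = dQ ^ 2 * 4 ^ (qA + E) := by
      simp only [Fintype.card_prod, Fintype.card_fun, Fintype.card_bool, Fintype.card_fin]
      rw [show 4 = 2 * 2 from rfl, mul_pow, pow_add]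
      ring
    rw [hcard] at h
    refine h.trans ((Nat.mul_le_mul_right _ (hbits qA E)).trans_eq ?_)
    ring
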